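/- Let $n\ge 1$ and $k\ge 0$ be integers. Consider $n$ men and $n$ women; each participant $x$ has a profile $\mathbf a(x)\in Q_k=\{0,1\}^k$ and a tie-breaking list $T_x$, an ordering of the $n$ members of the opposite side. Participant $x$ ranks the members of the opposite side by the Hamming distance of their profiles from $\mathbf a(x)$, closest first, those at equal distance in the order of $T_x$, and prefers every one of them to being unmatched. A matching pairs some of the men with distinct women and leaves the others unmatched; it is stable if no man and woman both strictly prefer each other to their situation in the matching. A stable partner of $x$ is a partner of $x$ in some stable matching. A stable matching always exists, and the Hamming distance between $x$ and the partner of $x$ is the same in all stable matchings; it is called the matching distance of $x$. All profiles and tie-breaking lists are chosen independently and uniformly at random, and $X$ denotes the matching distance of a participant chosen uniformly at random from all $2n$ participants, independently of the rest. **Theorem.** Let $k(n)$ be a sequence of nonnegative integers. (i) If $k(n)=\Omega(n^3)$ (that is, for some constant $c>0$, $k(n)\ge c\,n^3$ for all large $n$), then for $k=k(n)$ the fraction of the $2n$ participants that have more than one stable partner tends to $0$ in probability as $n\to\infty$: for every $\varepsilon>0$, the probability that it exceeds $\varepsilon$ tends to $0$. (ii) If $k(n)=\Omega(n^6)$, then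 for $k=k(n)$, with probability tending to $1$ as $n\to\infty$, the stable matching is unique without resorting to tie-breaking: the profiles are such that there is a matching $\mu$ which, for every choice of the tie-breaking lists, is the one and only stable matching. (iii) For all $n\ge 1$, $k\ge 0$ and all real $\beta>1$, $$\mathbb P\left(X<\frac k2-\sqrt{\beta k\log n}\right)\le n^{1-\beta},$$ where $\log$ is the natural logarithm. -/

import Mathlib

open Filter Asymptotics
open scoped Topology

namespace ProfileMatching

/-- The participants of a community of `n` men (`Sum.inl`) and `n` women (`Sum.inr`). -/
abbrev User (n : ℕ) : Type := Fin n ⊕ Fin n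

/-- `x` and `y` are on opposite sides of the market. -/
def Opposite {n : ℕ} (x y : User n) : Prop := x.isLeft ≠ y.isLeft

/-- The index of a participant within their own side of the market. -/
def idx {n : ℕ} : User n → Fin n := Sum.elim id id

/-- The profiles of all participants: each of them is a point of the hypercube `Q_k`. -/
abbrev Profiles (n k : ℕ) : Type := User n → Fin k → Bool

/-- The tie-breaking lists of all participants. `T x` is an ordering of the opposite side of `x`:
the member of index `i` has position `T x i` in the list (position `0` is the first one). -/
abbrev TieBreaks (n : ℕ) : Type := User n → Equiv.Perm (Fin n)

/-- An instance of the profile matching problem: profiles together with tie-breaking lists. -/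
abbrev Market (n k : ℕ) : Type := Profiles n k × TieBreaks n

/-- The Hamming distance between the profiles of two participants. -/
def dist {n k : ℕ} (a : Profiles n k) (x y : User n) : ℕ := hammingDist (a x) (a y)

/-- A matching: everybody is matched to somebody of the opposite side or is unmatched
(`partner x = x`), and the partner of the partner of `x` is `x`. -/
@[ext]
structure Matching (n : ℕ) where
  /-- The partner of a participant (the participant themselves if they are unmatched). -/
  partner : User n → User n
  partner_partner : ∀ x, partner (partner x) = x
  self_or_opposite : ∀ x, partner x = x ∨ Opposite x (partner x)

/-- `x` strictly prefers `y` (a member of the opposite side) to `z`, where `z` is either `x`, which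
stands for being unmatched and comes last, or a member of the opposite side. Members of the
opposite side are ranked by distance, and at equal distance by the tie-breaking list of `x`. -/
def Prefers {n k : ℕ} (M : Market n k) (x y z : User n) : Prop :=
  z = x ∨ dist M.1 x y < dist M.1 x z ∨
    (dist M.1 x y = dist M.1 x z ∧ M.2 x (idx y) < M.2 x (idx z))

/-- `x` and `y`, on opposite sides, prefer each other to their partners under `μ`. -/
def Blocking {n k : ℕ} (M : Market n k) (μ : Matching n) (x y : User n) : Prop :=
  Opposite x y ∧ Prefers M x y (μ.partner x) ∧ Prefers M y x (μ.partner y)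

/-- A matching is stable if it has no blocking pair. -/
def Stable {n k : ℕ} (M : Market n k) (μ : Matching n) : Prop :=
  ∀ x y, ¬ Blocking M μ x y

/-- `y` is a stable partner of `x`: they are matched to each other in some stable matching. -/
def StablePartner {n k : ℕ} (M : Market n k) (x y : User n) : Prop :=
  y ≠ x ∧ ∃ μ : Matching n, Stable M μ ∧ μ.partner x = y

/-- The fraction of the `2 n` participants that have more than one stable partner. -/
noncomputable def multipleFraction {n k : ℕ} (M : Market n k) : ℝ :=
  (Set.ncard {x : User n | ∃ y y', y ≠ y' ∧ StablePartner M x y ∧ StablePartner M x y'} : ℝ) /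
    (2 * n)

/-- The stable matching is unique without resorting to tie-breaking: the profiles alone determine
it. That is, there is a matching which is the one and only stable matching whichever
tie-breaking lists are used. -/
def UniqueWithoutTieBreaking {n k : ℕ} (a : Profiles n k) : Prop :=
  ∃ μ : Matching n, ∀ (T : TieBreaks n) (ν : Matching n), Stable (a, T) ν ↔ ν = μ

/-- The matching distance of `x`: the distance between `x` and their partner in a stable matching.
(The infimum over all stable matchings; it is the common value for all of them.) -/
noncomputable def matchingDist {n k : ℕ} (M : Market n k) (x : User n) : ℕ :=
  sInf {d : ℕ | ∃ μ : Matching n, Stable M μ ∧ d = dist M.1 x (μ.partner x)}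

/-- The probability of an event under the uniform distribution on a finite type. For `Market n k`,
a finite product, it says that all the answers are independent fair bits, that all the tie-breaking
lists are uniformly distributed orderings, and that all of these are independent. -/
noncomputable def prob {α : Type} [Fintype α] [Nonempty α] (E : Set α) : ℝ :=
  ((PMF.uniformOfFintype α).toOuterMeasure E).toReal

end ProfileMatching

/-!
If two matchings are stable, those who strictly prefer the first are matched by it to those who
strictly prefer the second, and conversely. The distance of a couple is the same seen from either
side, so double counting it over these two groups shows that the two matchings give everybody the
same distance. The argument only needs that there are no blocking pairs at distances up to the one
in question.

If `x` has two stable partners, let `y` be the second one and `z` the partner of `y` in the first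
matching `μ`. Then `x` is at the same distance from `y` as from `μ x`, and `y` at the same distance
from `z`. Removing `y` and `z` leaves a matching which is stable up to that distance, so both
coincidences involve a number that is determined by the profiles of the others. Given those, the
distance to a uniformly random profile is binomial, hence takes each value with probability at most
`1 / √(k + 1)`, and the two coincidences together have probability at most `1 / (k + 1)`. If the
stable matching depends on the tie-breaking, then at the smallest distance at which two of the
matchings differ there is either such a double coincidence or a single one that survives the removal
of `y` alone. Summing over triples and pairs gives (i) for `k ≫ n ^ 2` and (ii) for `k ≫ n ^ 4`.

For (iii), somebody with a small matching distance has one of the `n` members of the opposite side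
that close, which Chernoff's bound makes unlikely.
-/

namespace ProfileMatching

open scoped BigOperators

variable {n k : ℕ}

section Preferences

variable {x y z : User n}

lemma Opposite.symm (h : Opposite x y) : Opposite y x := Ne.symm h

lemma Opposite.ne (h : Opposite x y) : x ≠ y := fun hxy => h (congrArg Sum.isLeft hxy)

lemma idx_injOn_opposite (x : User n) : Set.InjOn idx {y | Opposite x y} := by
  intro y hy z hz h
  rcases x with x | x <;> rcases y with y | y <;> rcases z with z | z <;>
    simp_all [Opposite, idx]

lemma dist_comm (a : Profiles n k) (x y : User n) : dist a x y = dist a y x :=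
  hammingDist_comm _ _

lemma dist_le (a : Profiles n k) (x y : User n) : dist a x y ≤ k :=
  hammingDist_le_card_fintype.trans_eq (Fintype.card_fin k)

lemma dist_congr {a b : Profiles n k} (hx : a x = b x) (hy : a y = b y) :
    dist a x y = dist b x y := by
  rw [dist, dist, hx, hy]

/-- The distance from `x` to a prospective partner `z`. Being unmatched, which is encoded as
`z = x`, counts as distance `k + 1`, more than any distance between profiles. -/
def gap (a : Profiles n k) (x z : User n) : ℕ := if z = x then k + 1 else dist a x z

lemma gap_self (a : Profiles n k) (x : User n) : gap a x x = k + 1 := if_pos rfl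

lemma gap_of_ne (a : Profiles n k) (h : z ≠ x) : gap a x z = dist a x z := if_neg h

lemma gap_comm (a : Profiles n k) (x y : User n) : gap a x y = gap a y x := by
  simp only [gap, dist_comm a x y, eq_comm]

lemma gap_lt_gap_self (a : Profiles n k) (h : z ≠ x) : gap a x z < gap a x x := by
  rw [gap_of_ne a h, gap_self]
  exact Nat.lt_succ_of_le (dist_le a x z)

lemma gap_le (a : Profiles n k) (x z : User n) : gap a x z ≤ k + 1 := by
  rcases eq_or_ne z x with rfl | h
  · exact (gap_self a z).le
  · exact (gap_lt_gap_self a h).le.trans_eq (gap_self a x)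

/-- The position of `z` in the preferences of `x`, the smaller the better: compare distances first
and then positions in the tie-breaking list. The list is irrelevant if `z = x`. -/
def rank (M : Market n k) (x z : User n) : ℕ ×ₗ Fin n := toLex (gap M.1 x z, M.2 x (idx z))

variable {M : Market n k}

lemma gap_le_of_rank_le (h : rank M x y ≤ rank M x z) : gap M.1 x y ≤ gap M.1 x z :=
  Prod.Lex.monotone_fst _ _ h

lemma rank_lt_of_gap_lt (h : gap M.1 x y < gap M.1 x z) : rank M x y < rank M x z :=
  Prod.Lex.toLex_lt_toLex.2 (Or.inl h)

lemma ne_of_rank_lt (h : rank M x y < rank M x z) : y ≠ x := by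
  rintro rfl
  rcases eq_or_ne z y with rfl | hz
  · exact lt_irrefl _ h
  · exact lt_asymm h (rank_lt_of_gap_lt (gap_lt_gap_self M.1 hz))

lemma prefers_iff_rank_lt (hy : y ≠ x) : Prefers M x y z ↔ rank M x y < rank M x z := by
  rcases eq_or_ne z x with rfl | hz
  · exact iff_of_true (Or.inl rfl) (rank_lt_of_gap_lt (gap_lt_gap_self M.1 hy))
  · simp only [Prefers, rank, Prod.Lex.toLex_lt_toLex, gap_of_ne _ hy, gap_of_ne _ hz, hz,
      false_or]

lemma rank_injOn (M : Market n k) (x : User n) :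
    Set.InjOn (rank M x) {y | y = x ∨ Opposite x y} := by
  intro y hy z hz h
  obtain ⟨hgap, htie⟩ : gap M.1 x y = gap M.1 x z ∧ M.2 x (idx y) = M.2 x (idx z) := by
    simpa only [rank, toLex_inj, Prod.mk.injEq] using h
  rcases hy with rfl | hy <;> rcases hz with rfl | hz
  · rfl
  · exact absurd hgap (gap_lt_gap_self M.1 hz.ne.symm).ne'
  · exact absurd hgap (gap_lt_gap_self M.1 hy.ne.symm).ne
  · exact idx_injOn_opposite x hy hz ((M.2 x).injective htie)

lemma prefers_of_dist_lt (h : dist M.1 x y < dist M.1 x z) : Prefers M x y z := Or.inr (Or.inl h)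

lemma Blocking.symm {μ : Matching n} (h : Blocking M μ x y) : Blocking M μ y x :=
  ⟨h.1.symm, h.2.2, h.2.1⟩

end Preferences

namespace Matching

variable (μ : Matching n) {x y : User n}

lemma partner_injective : Function.Injective μ.partner :=
  Function.LeftInverse.injective μ.partner_partner

lemma opposite_partner (h : μ.partner x ≠ x) : Opposite x (μ.partner x) :=
  (μ.self_or_opposite x).resolve_left h

lemma partner_mem (μ : Matching n) (x : User n) : μ.partner x ∈ {y | y = x ∨ Opposite x y} :=
  μ.self_or_opposite x

lemma gap_partner (a : Profiles n k) (x : User n) :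
    gap a (μ.partner x) (μ.partner (μ.partner x)) = gap a x (μ.partner x) := by
  rw [μ.partner_partner, gap_comm]

lemma partner_partner_ne_of_partner_ne {μ ν : Matching n} (h : μ.partner x ≠ ν.partner x) :
    μ.partner (μ.partner x) ≠ ν.partner (μ.partner x) := by
  rw [μ.partner_partner]
  intro hx
  apply h
  rw [← ν.partner_partner (μ.partner x), ← hx]

lemma exists_partner_eq_of_rel {R : User n → User n → Prop} (hsymm : ∀ x y, R x y → R y x)
    (hunique : Relator.RightUnique R) (hopp : ∀ x y, R x y → Opposite x y) :
    ∃ μ : Matching n, ∀ x y, R x y → μ.partner x = y := by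
  classical
  let f : User n → User n := fun x => if h : ∃ y, R x y then h.choose else x
  have hf : ∀ {x y}, R x y → f x = y := fun {x y} hxy =>
    have h : ∃ y, R x y := ⟨y, hxy⟩
    (dif_pos h).trans (hunique h.choose_spec hxy)
  have hf' : ∀ {x}, (¬ ∃ y, R x y) → f x = x := fun h => dif_neg h
  refine ⟨⟨f, fun x => ?_, fun x => ?_⟩, fun x y => hf⟩ <;> by_cases h : ∃ y, R x y
  · obtain ⟨y, hxy⟩ := h
    rw [hf hxy, hf (hsymm x y hxy)]
  · rw [hf' h, hf' h]
  · obtain ⟨y, hxy⟩ := h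
    exact Or.inr ((hf hxy).symm ▸ hopp x y hxy)
  · exact Or.inl (hf' h)

/-- The matching obtained by separating `y` from their partner. -/
def separate (y : User n) : Matching n where
  partner x := if x = y ∨ μ.partner x = y then x else μ.partner x
  partner_partner x := by
    by_cases h : x = y ∨ μ.partner x = y
    · simp only [h, if_true]
    · have h' : ¬ (μ.partner x = y ∨ μ.partner (μ.partner x) = y) := by
        rwa [μ.partner_partner, or_comm]
      rw [if_neg h, if_neg h', μ.partner_partner]
  self_or_opposite x := by
    split
    · exact Or.inl rfl
    · exact μ.self_or_opposite x

lemma separate_partner_of_ne (h : x ≠ y) (h' : x ≠ μ.partner y) :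
    (μ.separate y).partner x = μ.partner x :=
  if_neg (not_or.2 ⟨h, fun hx => h' (by rw [← hx, μ.partner_partner])⟩)

lemma separate_partner_self (y : User n) : (μ.separate y).partner y = y := if_pos (Or.inl rfl)

lemma separate_partner_partner (y : User n) :
    (μ.separate y).partner (μ.partner y) = μ.partner y :=
  if_pos (Or.inr (μ.partner_partner y))

end Matching

section Existence

variable {E A B ρ σ : Type*} [LinearOrder ρ] [LinearOrder σ]

/-- The elements of `X` that lose against a better element of `X` in the same fibre of `p`. If the
elements of `X` are proposals, `p` is their addressee and `r` is the rank the addressee gives them,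
these are the proposals that are turned down. -/
def rejected (p : E → A) (r : E → ρ) (X : Set E) : Set E :=
  {e | e ∈ X ∧ ∃ f ∈ X, p f = p e ∧ r f < r e}

lemma rejected_mono (p : E → A) (r : E → ρ) : Monotone (rejected p r) :=
  fun _ _ hXY _ ⟨he, f, hf, hlt⟩ => ⟨hXY he, f, hXY hf, hlt⟩

lemma injOn_sdiff_rejected {p : E → A} {r : E → ρ} (hpr : Function.Injective fun e => (p e, r e))
    (X : Set E) : Set.InjOn p (X \ rejected p r X) := by
  intro e he f hf hef
  refine hpr (Prod.ext hef (le_antisymm ?_ ?_))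
  · exact not_lt.1 fun h => he.2 ⟨he.1, f, hf.1, hef.symm, h⟩
  · exact not_lt.1 fun h => hf.2 ⟨hf.1, e, he.1, hef, h⟩

lemma exists_lt_of_mem_rejected [WellFoundedLT ρ] {p : E → A} {r : E → ρ} {X : Set E} {e : E}
    (he : e ∈ rejected p r X) : ∃ f ∈ X \ rejected p r X, p f = p e ∧ r f < r e := by
  obtain ⟨-, g, hg, hgp, hgr⟩ := he
  obtain ⟨f, ⟨hf, hfp⟩, hmin⟩ :=
    (InvImage.wf r wellFounded_lt).has_min {f | f ∈ X ∧ p f = p e} ⟨g, hg, hgp⟩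
  refine ⟨f, ⟨hf, ?_⟩, hfp, (not_lt.1 (hmin g ⟨hg, hgp⟩)).trans_lt hgr⟩
  rintro ⟨-, g', hg', hgp', hlt⟩
  exact hmin g' ⟨hg', hgp'.trans hfp⟩ hlt

lemma exists_stable_set [WellFoundedLT ρ] [WellFoundedLT σ] {p : E → A} {q : E → B} {r : E → ρ}
    {s : E → σ} (hpr : Function.Injective fun e => (p e, r e))
    (hqs : Function.Injective fun e => (q e, s e)) :
    ∃ Z : Set E, Set.InjOn p Z ∧ Set.InjOn q Z ∧
      ∀ e ∉ Z, (∃ f ∈ Z, p f = p e ∧ r f < r e) ∨ ∃ f ∈ Z, q f = q e ∧ s f < s e := by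
  -- Deferred acceptance: the `p`-side may choose from `X`, the `q`-side from `Y`, and each of
  -- these consists of everything that the other side has not turned down.
  obtain ⟨X, Y, hY, hX⟩ : ∃ X Y, (rejected p r X)ᶜ = Y ∧ (rejected q s Y)ᶜ = X := by
    let F : Set E →o Set E :=
      ⟨fun X => (rejected q s (rejected p r X)ᶜ)ᶜ, fun _ _ h =>
        Set.compl_subset_compl.2 (rejected_mono q s
          (Set.compl_subset_compl.2 (rejected_mono p r h)))⟩
    exact ⟨F.lfp, _, rfl, F.map_lfp⟩
  have hZ : X \ rejected p r X = Y \ rejected q s Y := by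
    rw [Set.sdiff_eq, Set.sdiff_eq, hY, hX, Set.inter_comm]
  refine ⟨X \ rejected p r X, injOn_sdiff_rejected hpr X, hZ ▸ injOn_sdiff_rejected hqs Y,
    fun e he => ?_⟩
  by_cases hp : e ∈ rejected p r X
  · exact Or.inl (exists_lt_of_mem_rejected hp)
  · have hq : e ∈ rejected q s Y := by
      by_contra hq
      exact he ⟨hX ▸ hq, hp⟩
    exact Or.inr (hZ ▸ exists_lt_of_mem_rejected hq)

lemma exists_matching_of_injOn {Z : Set (Fin n × Fin n)} (hmen : Set.InjOn Prod.fst Z)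
    (hwomen : Set.InjOn Prod.snd Z) :
    ∃ μ : Matching n, ∀ e ∈ Z,
      μ.partner (Sum.inl e.1) = Sum.inr e.2 ∧ μ.partner (Sum.inr e.2) = Sum.inl e.1 := by
  obtain ⟨μ, hμ⟩ := Matching.exists_partner_eq_of_rel
    (R := fun x y => ∃ e ∈ Z, x = Sum.inl e.1 ∧ y = Sum.inr e.2 ∨ x = Sum.inr e.2 ∧ y = Sum.inl e.1)
    (fun x y ⟨e, he, h⟩ => ⟨e, he, h.symm.imp And.symm And.symm⟩)
    (by
      rintro x y z ⟨e, he, ⟨rfl, rfl⟩ | ⟨rfl, rfl⟩⟩ ⟨f, hf, ⟨hx, rfl⟩ | ⟨hx, rfl⟩⟩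
      · rw [hmen he hf (Sum.inl_injective hx)]
      · cases hx
      · cases hx
      · rw [hwomen he hf (Sum.inr_injective hx)])
    (by rintro x y ⟨e, -, ⟨rfl, rfl⟩ | ⟨rfl, rfl⟩⟩ <;> simp [Opposite])
  exact ⟨μ, fun e he => ⟨hμ _ _ ⟨e, he, Or.inl ⟨rfl, rfl⟩⟩, hμ _ _ ⟨e, he, Or.inr ⟨rfl, rfl⟩⟩⟩⟩

theorem exists_stable (M : Market n k) : ∃ μ : Matching n, Stable M μ := by
  obtain ⟨Z, hmen, hwomen, hZ⟩ := exists_stable_set (E := Fin n × Fin n)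
    (p := Prod.fst) (r := fun e => rank M (Sum.inl e.1) (Sum.inr e.2))
    (q := Prod.snd) (s := fun e => rank M (Sum.inr e.2) (Sum.inl e.1))
    (by
      rintro ⟨i, j⟩ ⟨i', j'⟩ h
      obtain ⟨rfl, hr⟩ := Prod.mk.inj h
      simpa using rank_injOn M (Sum.inl i) (by simp [Opposite]) (by simp [Opposite]) hr)
    (by
      rintro ⟨i, j⟩ ⟨i', j'⟩ h
      obtain ⟨rfl, hr⟩ := Prod.mk.inj h
      simpa using rank_injOn M (Sum.inr j) (by simp [Opposite]) (by simp [Opposite]) hr)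
  obtain ⟨μ, hμ⟩ := exists_matching_of_injOn hmen hwomen
  have not_blocking : ∀ i j, ¬ Blocking M μ (Sum.inl i) (Sum.inr j) := by
    rintro i j ⟨h, hi, hj⟩
    rw [prefers_iff_rank_lt h.ne.symm] at hi
    rw [prefers_iff_rank_lt h.ne] at hj
    by_cases he : (i, j) ∈ Z
    · exact lt_irrefl _ ((hμ _ he).1 ▸ hi)
    · rcases hZ _ he with ⟨f, hf, rfl, hlt⟩ | ⟨f, hf, rfl, hlt⟩
      · exact lt_asymm hlt ((hμ f hf).1 ▸ hi)
      · exact lt_asymm hlt ((hμ f hf).2 ▸ hj)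
  refine ⟨μ, ?_⟩
  rintro (i | j) (i' | j') h
  · exact h.1 rfl
  · exact not_blocking _ _ h
  · exact not_blocking _ _ h.symm
  · exact h.1 rfl

end Existence

section Perfect

/-- The participant of index `i` on the side opposite to `x`. -/
def across (x : User n) (i : Fin n) : User n :=
  Sum.elim (fun _ => Sum.inr i) (fun _ => Sum.inl i) x

lemma opposite_across (x : User n) (i : Fin n) : Opposite x (across x i) := by
  rcases x with _ | _ <;> simp [across, Opposite]

lemma across_injective (x : User n) : Function.Injective (across x) := by
  rcases x with _ | _
  · exact Sum.inr_injective
  · exact Sum.inl_injective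

lemma Opposite.across_idx {x y : User n} (h : Opposite x y) : across x (idx y) = y := by
  rcases x with _ | _ <;> rcases y with _ | _ <;> simp_all [Opposite, across, idx]

lemma Opposite.opposite_iff {x y z w : User n} (hy : Opposite x y) (hz : Opposite x z) :
    Opposite y w ↔ Opposite z w := by
  have : y.isLeft = z.isLeft := (Bool.not_eq.2 hy).symm.trans (Bool.not_eq.2 hz)
  rw [Opposite, Opposite, this]

lemma Stable.partner_ne {M : Market n k} {μ : Matching n} (hμ : Stable M μ) (x : User n) :
    μ.partner x ≠ x := by
  intro hx
  have opposite (i j : Fin n) : Opposite (across x i) (μ.partner (across x j)) := by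
    refine ((opposite_across x i).opposite_iff (opposite_across x j)).2 (μ.opposite_partner ?_)
    exact fun hj => hμ x (across x j) ⟨opposite_across x j, Or.inl hx, Or.inl hj⟩
  -- The `n` participants opposite to `x` have `n` distinct partners, among them `x`.
  have injective : Function.Injective fun i => idx (μ.partner (across x i)) := fun i j hij =>
    across_injective x
      (μ.partner_injective (idx_injOn_opposite _ (opposite i i) (opposite i j) hij))
  obtain ⟨i, hi⟩ := Finite.surjective_of_injective injective (idx x)
  have hxi : μ.partner (across x i) = x :=
    idx_injOn_opposite (across x i) (opposite i i) (opposite_across x i).symm hi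
  exact (opposite_across x i).ne.symm (by rw [← μ.partner_partner (across x i), hxi, hx])

end Perfect

section Comparison

variable {M : Market n k} {S : Set (User n)} {d : ℕ} {μ ν : Matching n} {x : User n}

/-- `μ` is a matching of the participants in `S` without blocking pairs in `S` at distance at most
`d`. Everybody outside `S` stays unmatched. -/
structure StableUpTo (M : Market n k) (S : Set (User n)) (d : ℕ) (μ : Matching n) : Prop where
  partner_eq_self : ∀ x ∉ S, μ.partner x = x
  lt_dist : ∀ x ∈ S, ∀ y ∈ S, Blocking M μ x y → d < dist M.1 x y

lemma Stable.stableUpTo (h : Stable M μ) (d : ℕ) : StableUpTo M Set.univ d μ :=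
  ⟨fun x hx => absurd (Set.mem_univ x) hx, fun x _ y _ hxy => absurd hxy (h x y)⟩

namespace StableUpTo

lemma mono {e : ℕ} (h : StableUpTo M S e μ) (hde : d ≤ e) : StableUpTo M S d μ :=
  ⟨h.partner_eq_self, fun x hx y hy hxy => hde.trans_lt (h.lt_dist x hx y hy hxy)⟩

lemma mem (h : StableUpTo M S d μ) (hx : μ.partner x ≠ x) : x ∈ S :=
  of_not_not fun hxS => hx (h.partner_eq_self x hxS)

lemma partner_mem (h : StableUpTo M S d μ) (hx : x ∈ S) : μ.partner x ∈ S := by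
  by_contra hxS
  rw [← h.partner_eq_self _ hxS, μ.partner_partner] at hxS
  exact hxS hx

lemma rank_partner_lt (hμ : StableUpTo M S d μ) (hν : StableUpTo M S d ν)
    (hd : gap M.1 x (μ.partner x) ≤ d) (hlt : rank M x (μ.partner x) < rank M x (ν.partner x)) :
    rank M (μ.partner x) (ν.partner (μ.partner x)) <
      rank M (μ.partner x) (μ.partner (μ.partner x)) := by
  have hx : μ.partner x ≠ x := ne_of_rank_lt hlt
  have hxS : x ∈ S := hμ.mem hx
  have hne : μ.partner (μ.partner x) ≠ ν.partner (μ.partner x) :=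
    Matching.partner_partner_ne_of_partner_ne fun h => hlt.ne (congrArg (rank M x) h)
  refine lt_of_le_of_ne (not_lt.1 fun hlt' => ?_) fun h =>
    hne (rank_injOn M _ (μ.partner_mem _) (ν.partner_mem _) h.symm)
  rw [μ.partner_partner] at hlt'
  have hblock : Blocking M ν x (μ.partner x) :=
    ⟨μ.opposite_partner hx, (prefers_iff_rank_lt hx).2 hlt, (prefers_iff_rank_lt hx.symm).2 hlt'⟩
  rw [gap_of_ne _ hx] at hd
  exact hd.not_gt (hν.lt_dist x hxS _ (hμ.partner_mem hxS) hblock)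

end StableUpTo

open Classical in
/-- The participants who are matched at distance at most `d` by `μ` and prefer `μ` to `ν`. -/
noncomputable def winners (M : Market n k) (d : ℕ) (μ ν : Matching n) : Finset (User n) :=
  {x | gap M.1 x (μ.partner x) ≤ d ∧ rank M x (μ.partner x) < rank M x (ν.partner x)}

lemma mem_winners : x ∈ winners M d μ ν ↔
    gap M.1 x (μ.partner x) ≤ d ∧ rank M x (μ.partner x) < rank M x (ν.partner x) := by
  simp only [winners, Finset.mem_filter_univ]

lemma gap_le_of_mem_winners (hx : x ∈ winners M d μ ν) :
    gap M.1 x (μ.partner x) ≤ gap M.1 x (ν.partner x) :=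
  gap_le_of_rank_le (mem_winners.1 hx).2.le

namespace StableUpTo

lemma image_winners_subset (hμ : StableUpTo M S d μ) (hν : StableUpTo M S d ν) :
    (winners M d μ ν).image μ.partner ⊆ winners M d ν μ := by
  intro y hy
  obtain ⟨x, hx, rfl⟩ := Finset.mem_image.1 hy
  obtain ⟨hd, hlt⟩ := mem_winners.1 hx
  have hlt' := hμ.rank_partner_lt hν hd hlt
  refine mem_winners.2 ⟨(gap_le_of_rank_le hlt'.le).trans ?_, hlt'⟩
  rwa [μ.gap_partner]

lemma image_winners (hμ : StableUpTo M S d μ) (hν : StableUpTo M S d ν) :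
    (winners M d μ ν).image μ.partner = winners M d ν μ := by
  refine Finset.eq_of_subset_of_card_le (hμ.image_winners_subset hν) ?_
  calc (winners M d ν μ).card = ((winners M d ν μ).image ν.partner).card :=
        (Finset.card_image_of_injective _ ν.partner_injective).symm
    _ ≤ (winners M d μ ν).card := Finset.card_le_card (hν.image_winners_subset hμ)
    _ = ((winners M d μ ν).image μ.partner).card :=
        (Finset.card_image_of_injective _ μ.partner_injective).symm

lemma sum_gap_winners (hμ : StableUpTo M S d μ) (hν : StableUpTo M S d ν) :
    ∑ x ∈ winners M d ν μ, gap M.1 x (μ.partner x) =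
      ∑ x ∈ winners M d μ ν, gap M.1 x (μ.partner x) := by
  rw [← hμ.image_winners hν, Finset.sum_image μ.partner_injective.injOn]
  exact Finset.sum_congr rfl fun x _ => μ.gap_partner M.1 x

lemma gap_eq_of_mem_winners (hμ : StableUpTo M S d μ) (hν : StableUpTo M S d ν)
    (hx : x ∈ winners M d μ ν) : gap M.1 x (μ.partner x) = gap M.1 x (ν.partner x) := by
  -- Winners of `μ` gain, winners of `ν` lose, but the partners of the former are the latter.
  have hsum : ∑ x ∈ winners M d μ ν, gap M.1 x (ν.partner x) ≤
      ∑ x ∈ winners M d μ ν, gap M.1 x (μ.partner x) := by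
    rw [← hμ.sum_gap_winners hν, hν.sum_gap_winners hμ]
    exact Finset.sum_le_sum fun _ => gap_le_of_mem_winners
  exact (Finset.sum_eq_sum_iff_of_le fun _ => gap_le_of_mem_winners).1
    (le_antisymm (Finset.sum_le_sum fun _ => gap_le_of_mem_winners) hsum) x hx

lemma gap_eq (hμ : StableUpTo M S d μ) (hν : StableUpTo M S d ν)
    (hd : gap M.1 x (μ.partner x) ≤ d) : gap M.1 x (ν.partner x) = gap M.1 x (μ.partner x) := by
  rcases lt_trichotomy (rank M x (μ.partner x)) (rank M x (ν.partner x)) with hlt | heq | hgt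
  · exact (hμ.gap_eq_of_mem_winners hν (mem_winners.2 ⟨hd, hlt⟩)).symm
  · rw [rank_injOn M x (μ.partner_mem x) (ν.partner_mem x) heq]
  · exact hν.gap_eq_of_mem_winners hμ
      (mem_winners.2 ⟨(gap_le_of_rank_le hgt.le).trans hd, hgt⟩)

end StableUpTo

lemma Stable.dist_eq (hμ : Stable M μ) (hν : Stable M ν) (x : User n) :
    dist M.1 x (ν.partner x) = dist M.1 x (μ.partner x) := by
  rw [← gap_of_ne M.1 (hμ.partner_ne x), ← gap_of_ne M.1 (hν.partner_ne x)]
  exact (hμ.stableUpTo (k + 1)).gap_eq (hν.stableUpTo (k + 1)) (gap_le _ _ _)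

lemma Stable.dist_eq_matchingDist (hμ : Stable M μ) (x : User n) :
    dist M.1 x (μ.partner x) = matchingDist M x := by
  have : {d | ∃ ν : Matching n, Stable M ν ∧ d = dist M.1 x (ν.partner x)} =
      {dist M.1 x (μ.partner x)} :=
    Set.eq_singleton_iff_unique_mem.2
      ⟨⟨μ, hμ, rfl⟩, fun _ ⟨_, hν, hd⟩ => hd.trans (hμ.dist_eq hν x)⟩
  rw [matchingDist, this, csInf_singleton]

end Comparison

section Coincidence

variable {M : Market n k} {S : Set (User n)} {x y z : User n} {d e : ℕ}

/-- `d` is the distance at which `x` is matched by some matching of the participants in `S` that is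
stable up to distance `d`. By `IsMatchingDistOn.unique` there is at most one such `d`; if `S` is
everybody, it is the matching distance. -/
def IsMatchingDistOn (M : Market n k) (S : Set (User n)) (x : User n) (d : ℕ) : Prop :=
  ∃ μ : Matching n, StableUpTo M S d μ ∧ μ.partner x ≠ x ∧ dist M.1 x (μ.partner x) = d

namespace IsMatchingDistOn

lemma mem (h : IsMatchingDistOn M S x d) : x ∈ S := by
  obtain ⟨μ, hμ, hx, -⟩ := h
  exact hμ.mem hx

lemma le (hd : IsMatchingDistOn M S x d) (he : IsMatchingDistOn M S x e) : e ≤ d := by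
  obtain ⟨μ, hμ, hx, rfl⟩ := hd
  obtain ⟨ν, hν, hx', rfl⟩ := he
  by_contra! hlt
  have := hμ.gap_eq (hν.mono hlt.le) (gap_of_ne _ hx).le
  rw [gap_of_ne _ hx, gap_of_ne _ hx'] at this
  exact hlt.ne' this

lemma unique (hd : IsMatchingDistOn M S x d) (he : IsMatchingDistOn M S x e) : d = e :=
  le_antisymm (he.le hd) (hd.le he)

lemma congr {a b : Profiles n k} {T : TieBreaks n} (hab : Set.EqOn a b S)
    (h : IsMatchingDistOn (a, T) S x d) : IsMatchingDistOn (b, T) S x d := by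
  obtain ⟨μ, hμ, hx, hd⟩ := h
  have hdist {y z : User n} (hy : y ∈ S) (hz : z ∈ S) : dist b y z = dist a y z :=
    dist_congr (hab hy).symm (hab hz).symm
  refine ⟨μ, ⟨hμ.partner_eq_self, fun y hy z hz ⟨hyz, hyz', hzy'⟩ => ?_⟩, hx, ?_⟩
  · rw [hdist hy hz]
    refine hμ.lt_dist y hy z hz ⟨hyz, ?_, ?_⟩
    · simpa only [Prefers, hdist hy hz, hdist hy (hμ.partner_mem hy)] using hyz'
    · simpa only [Prefers, hdist hz hy, hdist hz (hμ.partner_mem hz)] using hzy'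
  · rw [hdist (hμ.mem hx) (hμ.partner_mem (hμ.mem hx)), hd]

end IsMatchingDistOn

/-- The distance from `x` to `y` is the matching distance of `x` in the market without `y`. -/
def Coincidence (M : Market n k) (x y : User n) : Prop :=
  IsMatchingDistOn M {y}ᶜ x (dist M.1 x y)

/-- The distances from `y` to `x` and to `z` are both the matching distance of `x` in the market
without `y` and `z`. -/
def DoubleCoincidence (M : Market n k) (x y z : User n) : Prop :=
  IsMatchingDistOn M {y, z}ᶜ x (dist M.1 x y) ∧ z ≠ y ∧ dist M.1 z y = dist M.1 x y

variable {μ : Matching n}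

lemma Stable.eq_partner_or_of_blocking_separate (hμ : Stable M μ) (hx : x ≠ y) (hz : z ≠ y)
    (h : Blocking M (μ.separate y) x z) : x = μ.partner y ∨ z = μ.partner y := by
  by_contra! hne
  obtain ⟨hxz, hxz', hzx'⟩ := h
  rw [μ.separate_partner_of_ne hx hne.1] at hxz'
  rw [μ.separate_partner_of_ne hz hne.2] at hzx'
  exact hμ x z ⟨hxz, hxz', hzx'⟩

lemma Stable.separate_stableUpTo (hμ : Stable M μ) (y : User n) (d : ℕ) :
    StableUpTo M {y, μ.partner y}ᶜ d (μ.separate y) := by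
  refine ⟨fun x hx => ?_, fun x hx z hz hxz => ?_⟩
  · rcases of_not_not hx with rfl | rfl
    · exact μ.separate_partner_self x
    · exact μ.separate_partner_partner y
  · obtain ⟨hx, hx'⟩ := not_or.1 hx
    obtain ⟨hz, hz'⟩ := not_or.1 hz
    exact ((hμ.eq_partner_or_of_blocking_separate hx hz hxz).elim hx' hz').elim

lemma Stable.dist_le_of_blocking_separate (hμ : Stable M μ) (hz : z ≠ y)
    (h : Blocking M (μ.separate y) (μ.partner y) z) :
    dist M.1 y (μ.partner y) ≤ dist M.1 (μ.partner y) z := by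
  obtain ⟨hopp, -, hprefers⟩ := h
  rw [μ.separate_partner_of_ne hz hopp.ne.symm] at hprefers
  by_contra! hlt
  refine hμ _ z ⟨hopp, prefers_of_dist_lt ?_, hprefers⟩
  rwa [μ.partner_partner, dist_comm _ _ y]

lemma Stable.separate_stableUpTo_of_lt (hμ : Stable M μ) (hd : d < dist M.1 y (μ.partner y)) :
    StableUpTo M {y}ᶜ d (μ.separate y) := by
  refine ⟨fun x hx => ?_, fun x hx z hz hxz => hd.trans_le ?_⟩
  · rw [of_not_not hx, μ.separate_partner_self]
  · rcases hμ.eq_partner_or_of_blocking_separate hx hz hxz with rfl | rfl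
    · exact hμ.dist_le_of_blocking_separate hz hxz
    · exact (hμ.dist_le_of_blocking_separate hx hxz.symm).trans_eq (dist_comm _ _ _)

lemma Stable.isMatchingDistOn (hμ : Stable M μ) (hxy : x ≠ y) (hx : μ.partner x ≠ y)
    (h : StableUpTo M S (dist M.1 x (μ.partner x)) (μ.separate y)) :
    IsMatchingDistOn M S x (dist M.1 x (μ.partner x)) := by
  have hpartner : (μ.separate y).partner x = μ.partner x :=
    μ.separate_partner_of_ne hxy fun h => hx (by rw [h, μ.partner_partner])
  exact ⟨_, h, by rw [hpartner]; exact hμ.partner_ne x, by rw [hpartner]⟩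

lemma Stable.coincidence (hμ : Stable M μ) (hxy : x ≠ y) (hx : μ.partner x ≠ y)
    (hd : dist M.1 x y = dist M.1 x (μ.partner x))
    (hlt : dist M.1 x (μ.partner x) < dist M.1 y (μ.partner y)) : Coincidence M x y := by
  rw [Coincidence, hd]
  exact hμ.isMatchingDistOn hxy hx (hμ.separate_stableUpTo_of_lt hlt)

lemma Stable.doubleCoincidence (hμ : Stable M μ) (hxy : x ≠ y) (hx : μ.partner x ≠ y)
    (hd : dist M.1 x y = dist M.1 x (μ.partner x))
    (heq : dist M.1 x (μ.partner x) = dist M.1 y (μ.partner y)) :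
    DoubleCoincidence M x y (μ.partner y) := by
  rw [DoubleCoincidence, hd]
  exact ⟨hμ.isMatchingDistOn hxy hx (hμ.separate_stableUpTo y _), hμ.partner_ne y,
    (dist_comm _ _ _).trans heq.symm⟩

lemma exists_doubleCoincidence
    (h : ∃ y y', y ≠ y' ∧ StablePartner M x y ∧ StablePartner M x y') :
    ∃ y z, DoubleCoincidence M x y z := by
  obtain ⟨-, -, hne, ⟨-, μ, hμ, rfl⟩, ⟨hx, ν, hν, rfl⟩⟩ := h
  refine ⟨_, _, hμ.doubleCoincidence hx.symm hne (hμ.dist_eq hν x) ?_⟩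
  calc dist M.1 x (μ.partner x) = dist M.1 x (ν.partner x) := (hμ.dist_eq hν x).symm
    _ = dist M.1 (ν.partner x) (ν.partner (ν.partner x)) := by rw [ν.partner_partner, dist_comm]
    _ = dist M.1 (ν.partner x) (μ.partner (ν.partner x)) := hμ.dist_eq hν (ν.partner x)

variable {a : Profiles n k} {T T' : TieBreaks n} {ν : Matching n}

lemma Stable.dist_partner_le_or (hμ : Stable M μ) (h : Opposite x y) :
    dist M.1 x (μ.partner x) ≤ dist M.1 x y ∨ dist M.1 y (μ.partner y) ≤ dist M.1 x y := by
  by_contra! hlt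
  exact hμ x y ⟨h, prefers_of_dist_lt hlt.1, prefers_of_dist_lt (dist_comm M.1 y x ▸ hlt.2)⟩

lemma Stable.exists_dist_partner_le (hμ : Stable (a, T) μ) (hν : Stable (a, T') ν)
    (hx : μ.partner x ≠ ν.partner x) :
    ∃ z, μ.partner z ≠ ν.partner z ∧ dist a z (μ.partner z) = dist a x (μ.partner x) ∧
      dist a z (ν.partner z) ≤ dist a x (μ.partner x) := by
  rcases hν.dist_partner_le_or (μ.opposite_partner (hμ.partner_ne x)) with hle | hle
  · exact ⟨x, hx, rfl, hle⟩
  · exact ⟨_, Matching.partner_partner_ne_of_partner_ne hx,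
      by rw [μ.partner_partner, dist_comm], hle⟩

lemma Stable.exists_dist_partner_eq_and_minimal (hμ : Stable (a, T) μ) (hν : Stable (a, T') ν)
    (hne : μ ≠ ν) :
    ∃ x, μ.partner x ≠ ν.partner x ∧ dist a x (ν.partner x) = dist a x (μ.partner x) ∧
      ∀ z, μ.partner z ≠ ν.partner z → dist a x (μ.partner x) ≤ dist a z (μ.partner z) := by
  have exists_min (f : User n → ℕ) : ∃ x, μ.partner x ≠ ν.partner x ∧
      ∀ z, μ.partner z ≠ ν.partner z → f x ≤ f z :=
    Set.exists_min_image {z | μ.partner z ≠ ν.partner z} f (Set.toFinite _)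
      (Function.ne_iff.1 fun h => hne (Matching.ext h))
  obtain ⟨x, hx, hxmin⟩ := exists_min fun z => dist a z (μ.partner z)
  obtain ⟨y, hy, hymin⟩ := exists_min fun z => dist a z (ν.partner z)
  obtain ⟨z, hz, hzx, hzν⟩ := hμ.exists_dist_partner_le hν hx
  obtain ⟨w, hw, -, hwμ⟩ := hν.exists_dist_partner_le hμ hy.symm
  refine ⟨z, hz, le_antisymm (hzν.trans_eq hzx.symm) ?_, hzx ▸ hxmin⟩
  calc dist a z (μ.partner z) = dist a x (μ.partner x) := hzx
    _ ≤ dist a w (μ.partner w) := hxmin w hw.symm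
    _ ≤ dist a y (ν.partner y) := hwμ
    _ ≤ dist a z (ν.partner z) := hymin z hz

lemma Stable.exists_coincidence (hμ : Stable (a, T) μ) (hν : Stable (a, T') ν) (hne : μ ≠ ν) :
    (∃ x y, Coincidence (a, T) x y) ∨ ∃ x y z, DoubleCoincidence (a, T) x y z := by
  obtain ⟨x, hx, hd, hmin⟩ := hμ.exists_dist_partner_eq_and_minimal hν hne
  have hy : μ.partner (ν.partner x) ≠ ν.partner (ν.partner x) :=
    (Matching.partner_partner_ne_of_partner_ne hx.symm).symm
  have hxy : x ≠ ν.partner x := (hν.partner_ne x).symm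
  rcases (hmin _ hy).lt_or_eq with hlt | heq
  · exact Or.inl ⟨_, _, hμ.coincidence hxy hx hd hlt⟩
  · exact Or.inr ⟨_, _, _, hμ.doubleCoincidence hxy hx hd heq⟩

lemma uniqueWithoutTieBreaking_of_forall_not (T : TieBreaks n)
    (h : ∀ x y, ¬ Coincidence (a, T) x y) (h' : ∀ x y z, ¬ DoubleCoincidence (a, T) x y z) :
    UniqueWithoutTieBreaking a := by
  obtain ⟨μ, hμ⟩ := exists_stable (a, T)
  have unique (T' : TieBreaks n) (ν : Matching n) (hν : Stable (a, T') ν) : ν = μ := by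
    by_contra hne
    rcases hμ.exists_coincidence hν (Ne.symm hne) with ⟨x, y, hxy⟩ | ⟨x, y, z, hxyz⟩
    · exact h x y hxy
    · exact h' x y z hxyz
  refine ⟨μ, fun T' ν => ⟨unique T' ν, ?_⟩⟩
  rintro rfl
  obtain ⟨ν', hν'⟩ := exists_stable (a, T')
  exact unique T' ν' hν' ▸ hν'

end Coincidence

section Probability

variable {Ω ι K : Type} [Fintype Ω] [Nonempty Ω]

lemma prob_eq_ncard_div (E : Set Ω) : prob E = E.ncard / Fintype.card Ω := by
  classical
  rw [prob, PMF.toOuterMeasure_uniformOfFintype_apply, ENNReal.toReal_div, ENNReal.toReal_natCast,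
    ENNReal.toReal_natCast, ← Nat.card_eq_fintype_card, Nat.card_coe_set_eq]

lemma prob_eq_expect (E : Set Ω) : prob E = 𝔼 ω, E.indicator 1 ω := by
  classical
  rw [prob_eq_ncard_div, Fintype.expect_eq_sum_div_card, Set.ncard_eq_toFinset_card']
  congr 1
  simp [Set.indicator_apply]

lemma prob_nonneg (E : Set Ω) : 0 ≤ prob E := ENNReal.toReal_nonneg

lemma prob_empty : prob (∅ : Set Ω) = 0 := by
  rw [prob_eq_ncard_div, Set.ncard_empty, Nat.cast_zero, zero_div]

lemma prob_mono {E F : Set Ω} (h : E ⊆ F) : prob E ≤ prob F := by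
  rw [prob_eq_ncard_div, prob_eq_ncard_div]
  gcongr
  exact Set.toFinite F

lemma prob_compl (E : Set Ω) : prob Eᶜ = 1 - prob E := by
  simp only [prob_eq_expect, Set.indicator_compl, Pi.sub_apply, Pi.one_apply,
    Finset.expect_sub_distrib, Fintype.expect_const]

lemma prob_union_le (E F : Set Ω) : prob (E ∪ F) ≤ prob E + prob F := by
  simp only [prob_eq_expect, ← Finset.expect_add_distrib]
  refine Finset.expect_le_expect fun ω _ => ?_
  rw [← Pi.add_apply, ← Set.indicator_union_add_inter]
  exact le_add_of_nonneg_right (Set.indicator_nonneg (fun _ _ => zero_le_one) ω)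

lemma expect_ncard [Fintype ι] (P : ι → Ω → Prop) :
    𝔼 ω, ({i | P i ω}.ncard : ℝ) = ∑ i, prob {ω | P i ω} := by
  classical
  simp only [prob_eq_expect, ← Finset.expect_sum_comm]
  refine Finset.expect_congr rfl fun ω _ => ?_
  rw [Set.ncard_eq_toFinset_card']
  simp [Set.indicator_apply]

lemma mul_prob_le_expect {f : Ω → ℝ} (hf : 0 ≤ f) (ε : ℝ) : ε * prob {ω | ε ≤ f ω} ≤ 𝔼 ω, f ω := by
  rw [prob_eq_expect, Finset.mul_expect]
  refine Finset.expect_le_expect fun ω _ => ?_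
  by_cases h : ω ∈ {ω | ε ≤ f ω}
  · rwa [Set.indicator_of_mem h, Pi.one_apply, mul_one]
  · rw [Set.indicator_of_notMem h, mul_zero]
    exact hf ω

lemma prob_exists_le_card_mul [Fintype ι] {P : ι → Ω → Prop} {c : ℝ}
    (h : ∀ i, prob {ω | P i ω} ≤ c) : prob {ω | ∃ i, P i ω} ≤ Fintype.card ι * c := by
  classical
  calc prob {ω | ∃ i, P i ω} ≤ prob {ω | (1 : ℝ) ≤ {i | P i ω}.ncard} := by
        refine prob_mono fun ω ⟨i, hi⟩ => ?_
        exact_mod_cast (Set.ncard_pos (Set.toFinite _)).2 ⟨i, hi⟩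
    _ ≤ ∑ i, prob {ω | P i ω} := by
        rw [← expect_ncard, ← one_mul (prob _)]
        exact mul_prob_le_expect (fun ω => Nat.cast_nonneg _) 1
    _ ≤ Fintype.card ι * c := by
        rw [← nsmul_eq_mul]
        exact Finset.sum_le_card_nsmul _ _ _ fun i _ => h i

lemma prob_prod_le {Ω' : Type} [Fintype Ω'] [Nonempty Ω'] {E : Set (Ω × Ω')} {c : ℝ}
    (h : ∀ ω', prob {ω | (ω, ω') ∈ E} ≤ c) : prob E ≤ c := by
  simp only [prob_eq_expect] at h
  rw [prob_eq_expect, ← Finset.univ_product_univ, Finset.expect_product, Finset.expect_comm]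
  exact Finset.expect_le Finset.univ_nonempty fun ω' _ => h ω'

section Update

variable [Fintype ι] [DecidableEq ι] [Fintype K] [Nonempty K]

lemma expect_update (i : ι) (f : (ι → K) → ℝ) :
    𝔼 a, 𝔼 b, f (Function.update a i b) = 𝔼 a, f a := by
  have swap : Function.Involutive
      fun p : (ι → K) × K => (Function.update p.1 i p.2, p.1 i) := fun p => by simp
  calc 𝔼 a, 𝔼 b, f (Function.update a i b)
      = 𝔼 p : (ι → K) × K, f (Function.update p.1 i p.2) := by
        rw [← Finset.univ_product_univ, Finset.expect_product]
    _ = 𝔼 p : (ι → K) × K, f p.1 := Fintype.expect_equiv swap.toPerm _ _ fun _ => rfl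
    _ = 𝔼 a, f a := by
        rw [← Finset.univ_product_univ, Finset.expect_product]
        simp only [Fintype.expect_const]

lemma prob_eq_expect_prob_update (i : ι) (E : Set (ι → K)) :
    prob E = 𝔼 a, prob {b | Function.update a i b ∈ E} := by
  simp only [prob_eq_expect]
  exact (expect_update i _).symm

lemma prob_le_mul_of_update (i : ι) {E F : Set (ι → K)} {c : ℝ}
    (hEF : ∀ a b, Function.update a i b ∈ E → a ∈ F)
    (h : ∀ a ∈ F, prob {b | Function.update a i b ∈ E} ≤ c) : prob E ≤ c * prob F := by
  rw [prob_eq_expect_prob_update i, prob_eq_expect F, Finset.mul_expect]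
  refine Finset.expect_le_expect fun a _ => ?_
  by_cases ha : a ∈ F
  · rw [Set.indicator_of_mem ha, Pi.one_apply, mul_one]
    exact h a ha
  · have hE : {b | Function.update a i b ∈ E} = ∅ :=
      Set.eq_empty_iff_forall_notMem.2 fun b hb => ha (hEF a b hb)
    rw [hE, prob_empty, Set.indicator_of_notMem ha, mul_zero]

lemma prob_le_of_update (i : ι) {E : Set (ι → K)} {c : ℝ}
    (h : ∀ a, prob {b | Function.update a i b ∈ E} ≤ c) : prob E ≤ c := by
  rw [prob_eq_expect_prob_update i]
  exact Finset.expect_le Finset.univ_nonempty fun a _ => h a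

end Update

end Probability

section Hamming

lemma sq_centralBinom_mul_le (m : ℕ) : m.centralBinom ^ 2 * (2 * m + 1) ≤ 16 ^ m := by
  induction m with
  | zero => simp
  | succ m ih =>
    refine Nat.le_of_mul_le_mul_left ?_ (Nat.pow_pos (Nat.succ_pos m) : 0 < (m + 1) ^ 2)
    calc (m + 1) ^ 2 * ((m + 1).centralBinom ^ 2 * (2 * (m + 1) + 1))
        = ((m + 1) * (m + 1).centralBinom) ^ 2 * (2 * m + 3) := by ring
      _ = m.centralBinom ^ 2 * (2 * m + 1) * (4 * ((2 * m + 1) * (2 * m + 3))) := by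
          rw [Nat.succ_mul_centralBinom_succ]
          ring
      _ ≤ 16 ^ m * (4 * (4 * (m + 1) ^ 2)) := by
          refine Nat.mul_le_mul ih (Nat.mul_le_mul_left 4 ?_)
          nlinarith
      _ = (m + 1) ^ 2 * 16 ^ (m + 1) := by ring

lemma centralBinom_succ_eq_two_mul_choose (m : ℕ) :
    (m + 1).centralBinom = 2 * (2 * m + 1).choose m := by
  rw [Nat.centralBinom_eq_two_mul_choose, Nat.mul_succ, Nat.choose_succ_succ,
    Nat.choose_symm_half]
  exact (two_mul _).symm

lemma sq_choose_mul_le (k d : ℕ) : k.choose d ^ 2 * (k + 1) ≤ 4 ^ k := by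
  suffices h : k.choose (k / 2) ^ 2 * (k + 1) ≤ 4 ^ k by
    refine le_trans ?_ h
    gcongr
    exact Nat.choose_le_middle d k
  obtain ⟨m, rfl | rfl⟩ := Nat.even_or_odd' k
  · rw [Nat.mul_div_cancel_left m two_pos, pow_mul]
    exact sq_centralBinom_mul_le m
  · have hm := sq_centralBinom_mul_le (m + 1)
    rw [centralBinom_succ_eq_two_mul_choose] at hm
    rw [show (2 * m + 1) / 2 = m by lia]
    have hpow : 4 * 4 ^ (2 * m + 1) = 16 ^ (m + 1) := by
      rw [← pow_succ', show 2 * m + 1 + 1 = 2 * (m + 1) by ring, pow_mul]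
      norm_num
    nlinarith [Nat.zero_le ((2 * m + 1).choose m ^ 2)]

variable {ι K : Type} [Fintype ι]

lemma ncard_hammingDist_eq (c : ι → Bool) (d : ℕ) :
    {b | hammingDist c b = d}.ncard = (Fintype.card ι).choose d := by
  classical
  rw [← Finset.card_univ, ← Finset.card_powersetCard, ← Set.ncard_coe_finset]
  refine Set.ncard_congr (fun b _ => ({i | c i ≠ b i} : Finset ι)) (fun b hb => ?_)
    (fun b b' _ _ h => ?_) fun s hs => ?_
  · simpa [Finset.mem_powersetCard, hammingDist] using hb
  · funext i
    have hi : c i ≠ b i ↔ c i ≠ b' i := by simpa using Finset.ext_iff.1 h i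
    revert hi
    cases c i <;> cases b i <;> cases b' i <;> decide
  · have hflip : ({i | c i ≠ (c i ^^ decide (i ∈ s))} : Finset ι) = s := by
      ext i
      rw [Finset.mem_filter_univ]
      cases c i <;> simp
    refine ⟨fun i => c i ^^ decide (i ∈ s), ?_, hflip⟩
    exact (congrArg Finset.card hflip).trans (Finset.mem_powersetCard.1 hs).2

variable [DecidableEq ι]

lemma prob_hammingDist_eq_le (c : ι → Bool) (d : ℕ) :
    prob {b | hammingDist c b = d} ≤ 1 / √(Fintype.card ι + 1) := by
  rw [prob_eq_ncard_div, ncard_hammingDist_eq, Fintype.card_fun, Fintype.card_bool,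
    div_le_div_iff₀ (by positivity) (by positivity), one_mul]
  refine le_of_sq_le_sq ?_ (by positivity)
  rw [mul_pow, Real.sq_sqrt (by positivity), ← Nat.cast_pow, ← Nat.cast_pow, ← pow_mul',
    pow_mul]
  exact_mod_cast sq_choose_mul_le (Fintype.card ι) d

lemma expect_prod [Fintype K] (f : ι → K → ℝ) :
    𝔼 b : ι → K, ∏ i, f i (b i) = ∏ i, 𝔼 x, f i x := by
  simp only [Fintype.expect_eq_sum_div_card, Finset.prod_div_distrib, Fintype.prod_sum,
    Fintype.card_fun, Finset.prod_const, Finset.card_univ, Nat.cast_pow]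

lemma expect_exp_hammingDist (c : ι → Bool) (l : ℝ) :
    𝔼 b, Real.exp (l * (Fintype.card ι / 2 - hammingDist c b)) =
      Real.cosh (l / 2) ^ Fintype.card ι := by
  have sum_eq (b : ι → Bool) : l * (Fintype.card ι / 2 - hammingDist c b) =
      ∑ i, if c i ≠ b i then -(l / 2) else l / 2 := by
    have h := Finset.card_filter_add_card_filter_not (s := Finset.univ) fun i => c i ≠ b i
    have hcast : (Fintype.card ι : ℝ) = hammingDist c b +
        ({i | ¬ c i ≠ b i} : Finset ι).card := by
      exact_mod_cast h.symm
    rw [Finset.sum_ite, Finset.sum_const, Finset.sum_const, nsmul_eq_mul, nsmul_eq_mul, hcast,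
      hammingDist]
    ring
  have expect_eq (x : Bool) : 𝔼 y, Real.exp (if x ≠ y then -(l / 2) else l / 2) =
      Real.cosh (l / 2) := by
    rw [Fintype.expect_eq_sum_div_card, Real.cosh_eq]
    cases x <;> simp [add_comm]
  simp only [sum_eq, Real.exp_sum]
  rw [expect_prod fun i y => Real.exp (if c i ≠ y then -(l / 2) else l / 2)]
  simp only [expect_eq, Finset.prod_const, Finset.card_univ]

lemma prob_hammingDist_le_exp (c : ι → Bool) (t : ℝ) {l : ℝ} (hl : 0 ≤ l) :
    prob {b | (hammingDist c b : ℝ) ≤ Fintype.card ι / 2 - t} ≤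
      Real.exp (Fintype.card ι * l ^ 2 / 8 - l * t) := by
  rw [Real.exp_sub, le_div_iff₀' (Real.exp_pos _)]
  calc Real.exp (l * t) * prob {b | (hammingDist c b : ℝ) ≤ Fintype.card ι / 2 - t}
      ≤ Real.exp (l * t) * prob {b | Real.exp (l * t) ≤
          Real.exp (l * (Fintype.card ι / 2 - hammingDist c b))} := by
        gcongr
        refine prob_mono fun b hb => ?_
        exact Real.exp_le_exp.2 (mul_le_mul_of_nonneg_left (le_sub_comm.1 hb) hl)
    _ ≤ Real.cosh (l / 2) ^ Fintype.card ι :=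
        (mul_prob_le_expect (fun _ => (Real.exp_pos _).le) _).trans_eq (expect_exp_hammingDist c l)
    _ ≤ Real.exp ((l / 2) ^ 2 / 2) ^ Fintype.card ι := by
        gcongr
        exact Real.cosh_le_exp_half_sq _
    _ = Real.exp (Fintype.card ι * l ^ 2 / 8) := by
        rw [← Real.exp_nat_mul]
        ring_nf

lemma prob_hammingDist_lt_le (c : ι → Bool) {s : ℝ} (hs : 0 ≤ s) :
    prob {b | (hammingDist c b : ℝ) < Fintype.card ι / 2 - √(s * Fintype.card ι)} ≤
      Real.exp (-(2 * s)) := by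
  rcases Nat.eq_zero_or_pos (Fintype.card ι) with h0 | hpos
  · have hempty : {b | (hammingDist c b : ℝ) <
        Fintype.card ι / 2 - √(s * Fintype.card ι)} = ∅ := by
      simp [h0, Set.eq_empty_iff_forall_notMem]
    rw [hempty, prob_empty]
    exact (Real.exp_pos _).le
  · have hN : (0 : ℝ) < Fintype.card ι := Nat.cast_pos.2 hpos
    set N : ℝ := (Fintype.card ι : ℝ)
    set t : ℝ := √(s * N)
    have ht : t ^ 2 = s * N := Real.sq_sqrt (by positivity)
    -- `l = 4 * t / N` minimizes the exponent `N * l ^ 2 / 8 - l * t`.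
    calc prob {b | (hammingDist c b : ℝ) < N / 2 - t}
        ≤ prob {b | (hammingDist c b : ℝ) ≤ N / 2 - t} :=
          prob_mono (Set.ofPred_subset_ofPred.2 fun _ => le_of_lt)
      _ ≤ Real.exp (N * (4 * t / N) ^ 2 / 8 - 4 * t / N * t) :=
          prob_hammingDist_le_exp c t (by positivity)
      _ = Real.exp (-(2 * s)) := by
          congr 1
          field_simp
          linear_combination (-16) * ht

end Hamming

section Application

lemma dist_update_right (a : Profiles n k) {x y : User n} (h : x ≠ y) (b : Fin k → Bool) :
    dist (Function.update a y b) x y = hammingDist (a x) b := by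
  rw [dist, Function.update_self, Function.update_of_ne h]

lemma prob_isMatchingDistOn_dist_le (T : TieBreaks n) {S : Set (User n)} (x : User n) {y : User n}
    (hy : y ∉ S) :
    prob {a : Profiles n k | IsMatchingDistOn (a, T) S x (dist a x y)} ≤ 1 / √(k + 1) := by
  refine prob_le_of_update y fun a => ?_
  set E := {b | Function.update a y b ∈
    {a : Profiles n k | IsMatchingDistOn (a, T) S x (dist a x y)}}
  -- Changing the profile of `y` does not affect the matching distance of `x` on `S`.
  have isMatchingDistOn {b : Fin k → Bool} (hb : b ∈ E) :
      IsMatchingDistOn (a, T) S x (hammingDist (a x) b) := by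
    have hxy : x ≠ y := fun h => hy (h ▸ IsMatchingDistOn.mem hb)
    rw [← dist_update_right a hxy b]
    exact IsMatchingDistOn.congr
      (fun z hz => Function.update_of_ne (ne_of_mem_of_not_mem hz hy) b a) hb
  rcases E.eq_empty_or_nonempty with hE | ⟨b₀, hb₀⟩
  · rw [hE, prob_empty]
    positivity
  · have h := prob_hammingDist_eq_le (a x) (hammingDist (a x) b₀)
    rw [Fintype.card_fin] at h
    exact (prob_mono fun b hb => (isMatchingDistOn hb).unique (isMatchingDistOn hb₀)).trans h

lemma prob_coincidence_le (x y : User n) :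
    prob {M : Market n k | Coincidence M x y} ≤ 1 / √(k + 1) :=
  prob_prod_le fun T => prob_isMatchingDistOn_dist_le T x (Set.notMem_compl_iff.2 rfl)

lemma prob_doubleCoincidence_le (x y z : User n) :
    prob {M : Market n k | DoubleCoincidence M x y z} ≤ 1 / (k + 1) := by
  refine prob_prod_le fun T => ?_
  let F : Set (Profiles n k) := {a | IsMatchingDistOn (a, T) {y, z}ᶜ x (dist a x y)}
  have hF : prob F ≤ 1 / √(k + 1) := prob_isMatchingDistOn_dist_le T x (by simp)
  calc prob {a : Profiles n k | DoubleCoincidence (a, T) x y z} ≤ 1 / √(k + 1) * prob F := by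
        refine prob_le_mul_of_update z (fun a b ⟨hd, hzy, _⟩ => ?_) fun a _ => ?_
        · have hxz : x ≠ z := fun h => hd.mem (Or.inr h)
          have hcongr : Set.EqOn (Function.update a z b) a {z}ᶜ := fun w hw =>
            Function.update_of_ne hw b a
          rw [dist_congr (hcongr hxz) (hcongr hzy.symm)] at hd
          exact hd.congr (hcongr.mono (Set.compl_subset_compl.2 (by simp)))
        · have h := prob_hammingDist_eq_le (a y) (dist a x y)
          rw [Fintype.card_fin] at h
          refine le_trans (prob_mono fun b ⟨hd, hzy, hdist⟩ => ?_) h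
          have hxz : x ≠ z := fun h => hd.mem (Or.inr h)
          rw [dist_comm, dist_update_right a hzy.symm] at hdist
          exact hdist.trans (dist_congr (Function.update_of_ne hxz b a)
            (Function.update_of_ne hzy.symm b a))
    _ ≤ 1 / √(k + 1) * (1 / √(k + 1)) := by gcongr
    _ = 1 / (k + 1) := by
        rw [div_mul_div_comm, one_mul, Real.mul_self_sqrt (by positivity)]

lemma card_user (n : ℕ) : (Fintype.card (User n) : ℝ) = 2 * n := by
  rw [Fintype.card_sum, Fintype.card_fin, Nat.cast_add, two_mul]

lemma prob_exists_doubleCoincidence_le (x : User n) :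
    prob {M : Market n k | ∃ y z, DoubleCoincidence M x y z} ≤ (2 * n) ^ 2 / (k + 1) := by
  refine (prob_exists_le_card_mul fun y => prob_exists_le_card_mul fun z =>
    prob_doubleCoincidence_le x y z).trans_eq ?_
  rw [card_user]
  ring

lemma prob_multipleFraction_le [NeZero n] {ε : ℝ} (hε : 0 < ε) :
    prob {M : Market n k | ε < multipleFraction M} ≤ (2 * n) ^ 2 / (k + 1) / ε := by
  have hn : (0 : ℝ) < n := Nat.cast_pos.2 (NeZero.pos n)
  have expect_le : 𝔼 M : Market n k, multipleFraction M ≤ (2 * n) ^ 2 / (k + 1) := by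
    simp only [multipleFraction, ← Finset.expect_div, expect_ncard]
    rw [div_le_iff₀ (by positivity), ← card_user, mul_comm, ← nsmul_eq_mul]
    exact Finset.sum_le_card_nsmul _ _ _ fun x _ =>
      card_user n ▸ (prob_mono fun _ => exists_doubleCoincidence).trans
        (prob_exists_doubleCoincidence_le x)
  rw [le_div_iff₀' hε]
  calc ε * prob {M : Market n k | ε < multipleFraction M}
      ≤ ε * prob {M : Market n k | ε ≤ multipleFraction M} := by
        gcongr
        exact prob_mono (Set.ofPred_subset_ofPred.2 fun _ => le_of_lt)
    _ ≤ 𝔼 M : Market n k, multipleFraction M :=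
        mul_prob_le_expect (fun M => div_nonneg (Nat.cast_nonneg _) (by positivity)) ε
    _ ≤ (2 * n) ^ 2 / (k + 1) := expect_le

lemma prob_not_uniqueWithoutTieBreaking_le (n k : ℕ) :
    prob {M : Market n k | ¬ UniqueWithoutTieBreaking M.1} ≤
      (2 * n) ^ 2 / √(k + 1) + (2 * n) ^ 3 / (k + 1) := by
  have hsub : {M : Market n k | ¬ UniqueWithoutTieBreaking M.1} ⊆
      {M | ∃ x y, Coincidence M x y} ∪ {M | ∃ x y z, DoubleCoincidence M x y z} := by
    intro M hM
    by_contra! h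
    simp only [Set.mem_union, Set.mem_ofPred_eq, not_or, not_exists] at h
    exact hM (uniqueWithoutTieBreaking_of_forall_not M.2 h.1 h.2)
  refine (prob_mono hsub).trans ((prob_union_le _ _).trans (add_le_add ?_ ?_))
  · refine (prob_exists_le_card_mul fun x => prob_exists_le_card_mul fun y =>
      prob_coincidence_le x y).trans_eq ?_
    rw [card_user]
    ring
  · refine (prob_exists_le_card_mul fun x => prob_exists_doubleCoincidence_le x).trans_eq ?_
    rw [card_user]
    ring

lemma prob_dist_lt_le {x y : User n} (hxy : x ≠ y) {s : ℝ} (hs : 0 ≤ s) :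
    prob {M : Market n k | (dist M.1 x y : ℝ) < k / 2 - √(s * k)} ≤ Real.exp (-(2 * s)) := by
  refine prob_prod_le fun T => prob_le_of_update y fun a => ?_
  simp only [Set.mem_ofPred_eq, dist_update_right a hxy]
  simpa only [Fintype.card_fin] using prob_hammingDist_lt_le (a x) hs

lemma prob_matchingDist_lt_le [NeZero n] {β : ℝ} (hβ : 0 ≤ β) :
    prob {p : Market n k × User n |
      (matchingDist p.1 p.2 : ℝ) < (k : ℝ) / 2 - √(β * k * Real.log n)} ≤
        (n : ℝ) ^ (1 - 2 * β) := by
  have hn : (0 : ℝ) < n := Nat.cast_pos.2 (NeZero.pos n)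
  rw [mul_right_comm]
  refine prob_prod_le fun x => ?_
  calc prob {M : Market n k | (matchingDist M x : ℝ) < (k : ℝ) / 2 - √(β * Real.log n * k)}
      ≤ prob {M : Market n k | ∃ i, (dist M.1 x (across x i) : ℝ) <
          (k : ℝ) / 2 - √(β * Real.log n * k)} := by
        refine prob_mono fun M hM => ?_
        obtain ⟨μ, hμ⟩ := exists_stable M
        refine ⟨idx (μ.partner x), ?_⟩
        rw [(μ.opposite_partner (hμ.partner_ne x)).across_idx, hμ.dist_eq_matchingDist]
        exact hM
    _ ≤ Fintype.card (Fin n) * Real.exp (-(2 * (β * Real.log n))) :=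
        prob_exists_le_card_mul fun i => prob_dist_lt_le (opposite_across x i).ne
          (mul_nonneg hβ (Real.log_natCast_nonneg n))
    _ = (n : ℝ) ^ (1 - 2 * β) := by
        rw [Fintype.card_fin, sub_eq_add_neg, Real.rpow_add hn, Real.rpow_one,
          Real.rpow_def_of_pos hn]
        ring_nf

end Application

section Limits

lemma tendsto_div_add_one {α : Type*} {l : Filter α} {f : α → ℝ} {k : α → ℕ}
    (h : f =o[l] fun i => (k i : ℝ)) : Tendsto (fun i => f i / (k i + 1)) l (𝓝 0) := by
  refine (h.trans_le fun i => ?_).tendsto_div_nhds_zero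
  rw [Real.norm_of_nonneg (by positivity), Real.norm_of_nonneg (by positivity)]
  exact (lt_add_one _).le

lemma tendsto_prob_multipleFraction {k : ℕ → ℕ}
    (hk : (fun n : ℕ => (n : ℝ) ^ 2) =o[atTop] (fun n : ℕ => (k n : ℝ))) {ε : ℝ} (hε : 0 < ε) :
    Tendsto (fun n : ℕ => prob {M : Market n (k n) | ε < multipleFraction M}) atTop (𝓝 0) := by
  have hlim : Tendsto (fun n : ℕ => (2 * n : ℝ) ^ 2 / (k n + 1) / ε) atTop (𝓝 0) := by
    simpa only [mul_pow, zero_div] using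
      (tendsto_div_add_one (hk.const_mul_left (2 ^ 2))).div_const ε
  refine squeeze_zero' (Eventually.of_forall fun n => prob_nonneg _) ?_ hlim
  filter_upwards [eventually_ne_atTop 0] with n hn
  have : NeZero n := ⟨hn⟩
  exact prob_multipleFraction_le hε

lemma tendsto_prob_uniqueWithoutTieBreaking {k : ℕ → ℕ}
    (hk : (fun n : ℕ => (n : ℝ) ^ 4) =o[atTop] (fun n : ℕ => (k n : ℝ))) :
    Tendsto (fun n : ℕ => prob {M : Market n (k n) | UniqueWithoutTieBreaking M.1})
      atTop (𝓝 1) := by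
  have hk' : (fun n : ℕ => (n : ℝ) ^ 3) =o[atTop] (fun n : ℕ => (k n : ℝ)) :=
    ((isLittleO_pow_pow_atTop_of_lt (by norm_num : 3 < 4)).comp_tendsto
      tendsto_natCast_atTop_atTop).trans hk
  have hlim₂ : Tendsto (fun n : ℕ => (2 * n : ℝ) ^ 2 / √(k n + 1)) atTop (𝓝 0) := by
    have h := (tendsto_div_add_one (hk.const_mul_left (2 ^ 4))).sqrt
    simp only [← mul_pow, Real.sqrt_zero] at h
    refine h.congr fun n => ?_
    rw [Real.sqrt_div (by positivity), show (2 * n : ℝ) ^ 4 = ((2 * n) ^ 2) ^ 2 by ring,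
      Real.sqrt_sq (by positivity)]
  have hlim₃ : Tendsto (fun n : ℕ => (2 * n : ℝ) ^ 3 / (k n + 1)) atTop (𝓝 0) := by
    simpa only [mul_pow] using tendsto_div_add_one (hk'.const_mul_left (2 ^ 3))
  have hlim : Tendsto (fun n : ℕ => prob {M : Market n (k n) | ¬ UniqueWithoutTieBreaking M.1})
      atTop (𝓝 0) :=
    squeeze_zero (fun n => prob_nonneg _) (fun n => prob_not_uniqueWithoutTieBreaking_le n (k n))
      (by simpa only [add_zero] using hlim₂.add hlim₃)
  refine (sub_zero (1 : ℝ) ▸ hlim.const_sub 1).congr fun n => ?_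
  rw [← prob_compl]
  exact congrArg prob (compl_compl {M : Market n (k n) | UniqueWithoutTieBreaking M.1})

end Limits

end ProfileMatching

open ProfileMatching in
theorem theorem3p3_general :
    (∀ k : ℕ → ℕ, (fun n : ℕ => (n : ℝ) ^ 2) =o[atTop] (fun n : ℕ => (k n : ℝ)) →
      ∀ ε : ℝ, 0 < ε →
        Tendsto (fun n : ℕ => prob {M : Market n (k n) | ε < multipleFraction M}) atTop (𝓝 0)) ∧
    (∀ k : ℕ → ℕ, (fun n : ℕ => (n : ℝ) ^ 4) =o[atTop] (fun n : ℕ => (k n : ℝ)) →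
      Tendsto (fun n : ℕ => prob {M : Market n (k n) | UniqueWithoutTieBreaking M.1})
        atTop (𝓝 1)) ∧
    (∀ (n k : ℕ) (M : Market n k), (∃ μ : Matching n, Stable M μ) ∧
      ∀ μ : Matching n, Stable M μ → ∀ x : User n, dist M.1 x (μ.partner x) = matchingDist M x) ∧
    (∀ (n k : ℕ) [NeZero n] (β : ℝ), 0 ≤ β →
      prob {p : Market n k × User n |
          (matchingDist p.1 p.2 : ℝ) < (k : ℝ) / 2 - Real.sqrt (β * k * Real.log n)} ≤
        (n : ℝ) ^ (1 - 2 * β)) :=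
  ⟨fun _ hk _ hε => tendsto_prob_multipleFraction hk hε,
    fun _ hk => tendsto_prob_uniqueWithoutTieBreaking hk,
    fun _ _ M => ⟨exists_stable M, fun _ hμ x => hμ.dist_eq_matchingDist x⟩,
    fun _ _ _ _ hβ => prob_matchingDist_lt_le hβ⟩

open ProfileMatching in
theorem theorem3p3 :
    -- (i) few participants have several stable partners
    (∀ k : ℕ → ℕ, (fun n : ℕ => (n : ℝ) ^ 3) =O[atTop] (fun n : ℕ => (k n : ℝ)) →
      ∀ ε : ℝ, 0 < ε →
        Tendsto (fun n : ℕ => prob {M : Market n (k n) | ε < multipleFraction M}) atTop (𝓝 0)) ∧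
    -- (ii) uniqueness without tie-breaking
    (∀ k : ℕ → ℕ, (fun n : ℕ => (n : ℝ) ^ 6) =O[atTop] (fun n : ℕ => (k n : ℝ)) →
      Tendsto (fun n : ℕ => prob {M : Market n (k n) | UniqueWithoutTieBreaking M.1})
        atTop (𝓝 1)) ∧
    -- the matching distance, which (iii) is about, is well defined
    (∀ (n k : ℕ) (M : Market n k), (∃ μ : Matching n, Stable M μ) ∧
      ∀ μ : Matching n, Stable M μ → ∀ x : User n, dist M.1 x (μ.partner x) = matchingDist M x) ∧
    -- (iii) lower tail of the matching distance `X` of a uniformly random participant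
    (∀ (n k : ℕ) [NeZero n] (β : ℝ), 1 < β →
      prob {p : Market n k × User n |
          (matchingDist p.1 p.2 : ℝ) < (k : ℝ) / 2 - Real.sqrt (β * k * Real.log n)} ≤
        (n : ℝ) ^ (1 - β)) := by
  obtain ⟨h₁, h₂, h₃, h₄⟩ := theorem3p3_general
  have isLittleO {p q : ℕ} (hpq : p < q) :
      (fun n : ℕ => (n : ℝ) ^ p) =o[atTop] (fun n : ℕ => (n : ℝ) ^ q) :=
    (isLittleO_pow_pow_atTop_of_lt hpq).comp_tendsto tendsto_natCast_atTop_atTop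
  refine ⟨fun k hk => h₁ k ((isLittleO (by norm_num)).trans_isBigO hk),
    fun k hk => h₂ k ((isLittleO (by norm_num)).trans_isBigO hk), h₃, fun n k _ β hβ => ?_⟩
  refine (h₄ n k β (by linarith)).trans (Real.rpow_le_rpow_of_exponent_le ?_ (by linarith))
  exact Nat.one_le_cast.2 NeZero.one_le
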